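/- Let $A$ be an alphabet with two distinct letters $a\neq b$. A square in a word $w$ over $A$ is a factor of $w$ (a block of consecutive letters) of the form $xx$ with $x$ a non-empty word; squares are counted as words, so that several occurrences of the same word $xx$ count once. The distinct-square-density of a non-empty word $w$ is the number of distinct squares in $w$ divided by the length of $w$. For $k\ge 1$ let $$X_k=a^{k-1}\,b\,a\,a^{k-1}\,b\,a^{k-1}\,b\,a\,a^{k-1}\,b\,a\,a^{k-1}\,b\,a^{k-1}\,b,$$ and for integers $1\le i<j$ let $$Y_{i,j}=X_iX_{i+1}\cdots X_j\,a\,a^{j-1}.$$ Then, for all integers $1\le i<j$, the word $Y_{i,j}$ has length $$7j+3+3j^2-3i^2$$ and contains exactly $$4j+\left\lfloor\tfrac{j}{2}\right\rfloor+1+\tfrac12\left(5j^2-3j-5i^2+3i\right)$$ distinct squares. Consequently, for every fixed $i\ge 1$, the distinct-square-density of $Y_{i,j}$ tends to $\frac56$ as $j\to\infty$. In particular, there exists a sequence of words over $A$ whose distinct-square-densities converge to $\frac56$. -/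

import Mathlib

open Filter Topology

/-- The squares in the word `w`, as a set of words (so that each square is counted once):
the factors of `w` of the form `xx` with `x` a non-empty word. -/
def distinctSquares {A : Type*} (w : List A) : Set (List A) :=
  {s | s <:+: w ∧ ∃ x : List A, x ≠ [] ∧ s = x ++ x}

theorem distinctSquares_finite {A : Type*} (w : List A) : (distinctSquares w).Finite :=
  (List.finite_toSet w.sublists).subset fun _ hs => List.mem_sublists.mpr hs.1.sublist

/-- The number of distinct squares in the word `w`. -/
noncomputable def numDistinctSquares {A : Type*} (w : List A) : ℕ :=
  (distinctSquares w).ncard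

/-- The distinct-square-density of the word `w`: the number of distinct squares in `w` divided by
the length of `w`. -/
noncomputable def distinctSquareDensity {A : Type*} (w : List A) : ℝ :=
  (numDistinctSquares w : ℝ) / (w.length : ℝ)

/-- The word `X_k = a^{k-1} b a a^{k-1} b a^{k-1} b a a^{k-1} b a a^{k-1} b a^{k-1} b`
(meaningful for `k ≥ 1`). -/
def wordX {A : Type*} (a b : A) (k : ℕ) : List A :=
  List.replicate (k - 1) a ++ [b, a] ++ List.replicate (k - 1) a ++ [b] ++
    List.replicate (k - 1) a ++ [b, a] ++ List.replicate (k - 1) a ++ [b, a] ++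
    List.replicate (k - 1) a ++ [b] ++ List.replicate (k - 1) a ++ [b]

/-- The word `Y_{i,j} = X_i X_{i+1} ⋯ X_j a a^{j-1}` (meaningful for `1 ≤ i ≤ j`);
`List.range' i (j + 1 - i)` is the list `[i, i + 1, …, j]`. -/
def wordY {A : Type*} (a b : A) (i j : ℕ) : List A :=
  (List.range' i (j + 1 - i)).flatMap (wordX a b) ++ [a] ++ List.replicate (j - 1) a

/-! A word over two letters is determined by the lengths of its runs of `a` between consecutive
`b`s. With a closing `b` appended, `Y_{i,j}` has the run lengths `i - 1 + gap t` for `0 ≤ t ≤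
6(j+1-i)`; the block `X_k` supplies `k-1, k, k-1, k, k, k-1`.

Squares without `b` are the words `a^{2l}` with `1 ≤ l ≤ j/2`. A square containing `b` has a root
`a^r b … b a^s` with interior runs `ms`, so its own interior runs are `ms, s+r, ms`
(`core_eq_square_iff`). It is a factor exactly when these runs occur consecutively, flanked by runs
of length at least `r` and `s` (`core_isInfix_iff`). Hence, with `m` the length of `ms`, the run
sequence must repeat `m` consecutive values at distance `m+1`. As the values drift upwards, three
consecutive values never recur at distance 4 or more (`gap_aperiodic`), which leaves `m ≤ 2`.
Inspecting the position modulo 6 gives the five families of `squareCodes`.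

Each family has about `k` members for each `k`, while `X_k` has length `6k+3`: hence the limiting
density `5/6`. -/

/-- The word `a^{g₁} b a^{g₂} b ⋯ a^{gₙ} b` with prescribed lengths of its runs of `a`. -/
def runs {A : Type*} (a b : A) (L : List ℕ) : List A :=
  L.flatMap fun g => List.replicate g a ++ [b]

/-- The word `a^r b a^{g₁} b ⋯ a^{gₙ} b a^s`. -/
def core {A : Type*} (a b : A) (r : ℕ) (L : List ℕ) (s : ℕ) : List A :=
  List.replicate r a ++ b :: (runs a b L ++ List.replicate s a)

/-! ### Run-length coding of words, factors and squares -/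

section Runs

variable {A : Type*} {a b : A}

theorem runs_nil : runs a b [] = [] := rfl

theorem runs_cons (g : ℕ) (L : List ℕ) :
    runs a b (g :: L) = List.replicate g a ++ b :: runs a b L := by
  simp [runs]

theorem runs_append (L M : List ℕ) : runs a b (L ++ M) = runs a b L ++ runs a b M := by
  simp [runs]

theorem mem_runs {L : List ℕ} {c : A} (h : c ∈ runs a b L) : c = a ∨ c = b := by
  simp only [runs, List.mem_flatMap, List.mem_append, List.mem_replicate,
    List.mem_singleton] at h
  tauto

theorem exists_eq_runs_append_replicate (w : List A) (h : ∀ c ∈ w, c = a ∨ c = b) :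
    ∃ L t, w = runs a b L ++ List.replicate t a := by
  induction w with
  | nil => exact ⟨[], 0, rfl⟩
  | cons c w ih =>
    obtain ⟨L, t, rfl⟩ := ih fun c hc => h c (List.mem_cons_of_mem _ hc)
    rcases h c List.mem_cons_self with rfl | rfl
    · cases L with
      | nil => exact ⟨[], t + 1, by simp [runs, List.replicate_succ]⟩
      | cons g L => exact ⟨(g + 1) :: L, t, by simp [runs_cons, List.replicate_succ]⟩
    · exact ⟨0 :: L, t, by simp [runs_cons]⟩

theorem replicate_append_cons_inj (hab : a ≠ b) {m n : ℕ} {u v : List A}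
    (h : List.replicate m a ++ b :: u = List.replicate n a ++ b :: v) : m = n ∧ u = v := by
  induction m generalizing n with
  | zero =>
    cases n with
    | zero => simpa using h
    | succ n => simp [List.replicate_succ, hab.symm] at h
  | succ m ih =>
    cases n with
    | zero => simp [List.replicate_succ, hab] at h
    | succ n =>
      simp only [List.replicate_succ, List.cons_append, List.cons.injEq, true_and] at h
      simpa using ih h

theorem replicate_append_cons_ne (hab : a ≠ b) (m n : ℕ) (u : List A) :
    List.replicate m a ++ b :: u ≠ List.replicate n a := by
  intro h
  have hb : b ∈ List.replicate n a := by rw [← h]; simp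
  exact hab (List.eq_of_mem_replicate hb).symm

theorem runs_append_replicate_inj (hab : a ≠ b) {L M : List ℕ} {s t : ℕ}
    (h : runs a b L ++ List.replicate s a = runs a b M ++ List.replicate t a) :
    L = M ∧ s = t := by
  induction L generalizing M with
  | nil =>
    cases M with
    | nil => simpa [runs_nil, List.replicate_inj] using congrArg List.length h
    | cons g M =>
      simp only [runs_nil, runs_cons, List.nil_append, List.append_assoc, List.cons_append] at h
      exact absurd h.symm (replicate_append_cons_ne hab _ _ _)
  | cons g L ih =>
    cases M with
    | nil =>
      simp only [runs_nil, runs_cons, List.nil_append, List.append_assoc, List.cons_append] at h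
      exact absurd h (replicate_append_cons_ne hab _ _ _)
    | cons g' M =>
      simp only [runs_cons, List.append_assoc, List.cons_append] at h
      obtain ⟨rfl, h'⟩ := replicate_append_cons_inj hab h
      obtain ⟨rfl, rfl⟩ := ih h'
      exact ⟨rfl, rfl⟩

theorem runs_injective (hab : a ≠ b) : Function.Injective (runs a b) := fun L M h =>
  (runs_append_replicate_inj hab (s := 0) (t := 0) (by simpa using h)).1

theorem core_eq_runs (r : ℕ) (L : List ℕ) (s : ℕ) :
    core a b r L s = runs a b (r :: L) ++ List.replicate s a := by
  simp [core, runs_cons]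

theorem core_inj (hab : a ≠ b) {r r' s s' : ℕ} {L L' : List ℕ}
    (h : core a b r L s = core a b r' L' s') : r = r' ∧ L = L' ∧ s = s' := by
  rw [core_eq_runs, core_eq_runs] at h
  simpa [and_assoc] using runs_append_replicate_inj hab h

theorem exists_runs_cons_eq (g : ℕ) (L : List ℕ) :
    ∃ v, runs a b (g :: L) = List.replicate g a ++ (v ++ [b]) := by
  rcases List.eq_nil_or_concat L with rfl | ⟨L, z, rfl⟩
  · exact ⟨[], by simp [runs]⟩
  · exact ⟨b :: (runs a b L ++ List.replicate z a), by simp [runs_cons, runs_append, runs_nil]⟩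

theorem exists_runs_cons_of_append (s : ℕ) (w : List A) (h : ∀ c ∈ w, c = a ∨ c = b) :
    ∃ g L, List.replicate s a ++ (w ++ [b]) = runs a b (g :: L) ∧ s ≤ g := by
  obtain ⟨L, t, rfl⟩ := exists_eq_runs_append_replicate w h
  cases L with
  | nil => exact ⟨s + t, [], by simp [runs, List.replicate_add,
      -List.replicate_append_replicate], by omega⟩
  | cons g L =>
    exact ⟨s + g, L ++ [t],
      by simp [runs_cons, runs_append, runs_nil, List.replicate_add,
      -List.replicate_append_replicate], by omega⟩

/-- The extra `b` is a sentinel: it closes the last run of `w`, so that this run is listed in `L`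
like the others. -/
theorem replicate_isInfix_iff (hab : a ≠ b) {w : List A} {L : List ℕ}
    (hw : w ++ [b] = runs a b L) (r : ℕ) :
    List.replicate r a <:+: w ↔ ∃ g ∈ L, r ≤ g := by
  constructor
  · rintro ⟨P, T, rfl⟩
    have hmem : ∀ c ∈ P ++ List.replicate r a ++ T, c = a ∨ c = b := fun c hc =>
      mem_runs (hw ▸ List.mem_append_left _ hc)
    obtain ⟨ps, t, hP⟩ := exists_eq_runs_append_replicate P fun c hc => hmem c (by simp [hc])
    obtain ⟨g, qs, hT, hg⟩ := exists_runs_cons_of_append (a := a) (b := b) (t + r) T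
      fun c hc => hmem c (by simp [hc])
    refine ⟨g, ?_, by omega⟩
    have : runs a b (ps ++ g :: qs) = runs a b L := by
      rw [← hw, runs_append, ← hT, hP]
      simp [List.replicate_add,
      -List.replicate_append_replicate]
    rw [← runs_injective hab this]
    simp
  · rintro ⟨g, hg, hr⟩
    obtain ⟨ps, qs, rfl⟩ := List.append_of_mem hg
    obtain ⟨v, hv⟩ := exists_runs_cons_eq (a := a) (b := b) g qs
    have hw' : w = runs a b ps ++ List.replicate g a ++ v := by
      rw [runs_append, hv] at hw
      exact List.append_cancel_right (bs := [b]) (by simpa using hw)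
    obtain ⟨d, rfl⟩ := Nat.exists_eq_add_of_le hr
    exact ⟨runs a b ps, List.replicate d a ++ v, by simp [hw', List.replicate_add,
      -List.replicate_append_replicate]⟩

/-- The letters `b` of the factor fix its interior runs exactly; the two outer runs may continue
into the surrounding word, so they are only bounded by the neighbouring runs. -/
theorem core_isInfix_iff (hab : a ≠ b) {w : List A} {L : List ℕ}
    (hw : w ++ [b] = runs a b L) (r : ℕ) (ms : List ℕ) (s : ℕ) :
    core a b r ms s <:+: w ↔
      ∃ ps t g qs, L = ps ++ t :: (ms ++ g :: qs) ∧ r ≤ t ∧ s ≤ g := by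
  constructor
  · rintro ⟨P, T, rfl⟩
    have hmem : ∀ c ∈ P ++ core a b r ms s ++ T, c = a ∨ c = b := fun c hc =>
      mem_runs (hw ▸ List.mem_append_left _ hc)
    obtain ⟨ps, t, hP⟩ := exists_eq_runs_append_replicate P fun c hc => hmem c (by simp [hc])
    obtain ⟨g, qs, hT, hg⟩ := exists_runs_cons_of_append (a := a) (b := b) s T
      fun c hc => hmem c (by simp [hc])
    refine ⟨ps, t + r, g, qs, ?_, by omega, hg⟩
    apply runs_injective hab
    rw [← hw, runs_append, runs_cons, runs_append, ← hT, hP]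
    simp [List.replicate_add, core, -List.replicate_append_replicate]
  · rintro ⟨ps, t, g, qs, rfl, hr, hs⟩
    obtain ⟨v, hv⟩ := exists_runs_cons_eq (a := a) (b := b) g qs
    have hw' : w = runs a b ps ++ List.replicate t a ++ b :: (runs a b ms ++
        List.replicate g a ++ v) := by
      rw [runs_append, runs_cons, runs_append, hv] at hw
      exact List.append_cancel_right (bs := [b]) (by simpa using hw)
    obtain ⟨d, rfl⟩ := Nat.exists_eq_add_of_le' hr
    obtain ⟨e, rfl⟩ := Nat.exists_eq_add_of_le hs
    exact ⟨runs a b ps ++ List.replicate d a, List.replicate e a ++ v, by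
      simp [hw', List.replicate_add, core, -List.replicate_append_replicate]⟩

/-- At the junction of the two copies, `a^s` and `a^r` merge into a single run. -/
theorem core_append_core (r : ℕ) (ms : List ℕ) (s : ℕ) :
    core a b r ms s ++ core a b r ms s = core a b r (ms ++ (s + r) :: ms) s := by
  simp [core, runs_append, runs_cons, List.replicate_add,
    -List.replicate_append_replicate]

theorem core_eq_square_iff (hab : a ≠ b) (r : ℕ) (L : List ℕ) (s : ℕ) :
    (∃ x : List A, x ≠ [] ∧ core a b r L s = x ++ x) ↔ ∃ ms, L = ms ++ (s + r) :: ms := by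
  constructor
  · rintro ⟨x, -, h⟩
    have hx : ∀ c ∈ x, c = a ∨ c = b := by
      intro c hc
      have : c ∈ core a b r L s := by rw [h]; simp [hc]
      rw [core_eq_runs, List.mem_append] at this
      rcases this with h | h
      · exact mem_runs h
      · exact Or.inl (List.eq_of_mem_replicate h)
    obtain ⟨ps, t, rfl⟩ := exists_eq_runs_append_replicate x hx
    -- A root without `b` is excluded, since its square would contain no `b`.
    cases ps with
    | nil =>
      rw [runs_nil, List.nil_append, ← List.replicate_add] at h
      exact absurd h (replicate_append_cons_ne hab _ _ _)
    | cons r' ms =>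
      rw [← core_eq_runs, core_append_core] at h
      obtain ⟨rfl, rfl, rfl⟩ := core_inj hab h
      exact ⟨ms, rfl⟩
  · rintro ⟨ms, rfl⟩
    exact ⟨core a b r ms s, by simp [core], (core_append_core r ms s).symm⟩

theorem map_range_eq_append_iff (G : ℕ → ℕ) (N r s : ℕ) (ms : List ℕ) :
    (∃ ps t g qs, (List.range (N + 1)).map G = ps ++ t :: (ms ++ g :: qs) ∧ r ≤ t ∧ s ≤ g) ↔
      ∃ p, p + ms.length + 1 ≤ N ∧ r ≤ G p ∧ s ≤ G (p + ms.length + 1) ∧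
        ms = (List.range ms.length).map fun l => G (p + 1 + l) := by
  have key : ∀ p m k, (List.range (p + (1 + (m + (1 + k))))).map G =
      (List.range p).map G ++ G p :: ((List.range m).map (fun l => G (p + 1 + l)) ++
        G (p + m + 1) :: (List.range k).map fun l => G (p + m + 2 + l)) := by
    intro p m k
    simp only [List.range_add, List.map_append, List.map_map, List.range_one, List.map_cons,
      List.cons_append, List.nil_append]
    congr! 5 with l
    · simp only [Function.comp, add_assoc]
    · omega
    · funext l
      simp only [Function.comp]
      congr 1
      omega
  constructor
  · rintro ⟨ps, t, g, qs, h, hr, hs⟩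
    have hl := congrArg List.length h
    simp only [List.length_map, List.length_range, List.length_append, List.length_cons] at hl
    have hN : N + 1 = ps.length + (1 + (ms.length + (1 + qs.length))) := by omega
    rw [hN, key] at h
    obtain ⟨-, h⟩ := List.append_inj h (by simp)
    rw [List.cons.injEq] at h
    obtain ⟨ht, h⟩ := h
    obtain ⟨hms, h⟩ := List.append_inj h (by simp)
    rw [List.cons.injEq] at h
    exact ⟨ps.length, by omega, by omega, by omega, hms.symm⟩
  · rintro ⟨p, hN, hr, hs, hms⟩
    obtain ⟨k, hk⟩ := Nat.exists_eq_add_of_le hN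
    refine ⟨(List.range p).map G, G p, G (p + ms.length + 1),
      (List.range k).map fun l => G (p + ms.length + 2 + l), ?_, hr, hs⟩
    rw [show N + 1 = p + (1 + (ms.length + (1 + k))) by omega, key, ← hms]

end Runs

/-! ### The run-length sequence and the length of `Y_{i,j}` -/

/-- The lengths of the runs of `a` in `wordY a b 1 j`. -/
def gap (t : ℕ) : ℕ := t / 6 + if t % 6 = 1 ∨ t % 6 = 3 ∨ t % 6 = 4 then 1 else 0

theorem gap_add (q r : ℕ) : gap (6 * q + r) = q + gap r := by
  simp only [gap]
  rw [show (6 * q + r) % 6 = r % 6 by omega, show (6 * q + r) / 6 = q + r / 6 by omega, add_assoc]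

theorem gap_values : gap 0 = 0 ∧ gap 1 = 1 ∧ gap 2 = 0 ∧ gap 3 = 1 ∧ gap 4 = 1 ∧ gap 5 = 0 ∧
    gap 6 = 1 ∧ gap 7 = 2 ∧ gap 8 = 1 ∧ gap 9 = 2 ∧ gap 10 = 2 ∧ gap 11 = 1 := by
  decide

theorem gap_le_of_le {t n : ℕ} (h : t ≤ 6 * n) : gap t ≤ n := by
  unfold gap
  split_ifs <;> omega

/-- Up to adding `q`, the windows of three values are `010, 101, 011, 110, 101, 012` for the
residues 0 to 5 of the start. Only those at residues 1 and 4 of the same block agree, and they are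
at distance 3. -/
theorem gap_aperiodic {t d : ℕ} (hd : 4 ≤ d) (h0 : gap t = gap (t + d))
    (h1 : gap (t + 1) = gap (t + d + 1)) (h2 : gap (t + 2) = gap (t + d + 2)) : False := by
  obtain ⟨u, hu⟩ : ∃ u, u = t + d := ⟨_, rfl⟩
  rw [← hu] at h0 h1 h2
  have ht := Nat.div_add_mod t 6
  have hu' := Nat.div_add_mod u 6
  have hc := Nat.mod_lt t (show 0 < 6 by norm_num)
  have hc' := Nat.mod_lt u (show 0 < 6 by norm_num)
  generalize t / 6 = q at *
  generalize t % 6 = c at *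
  generalize u / 6 = q' at *
  generalize u % 6 = c' at *
  subst ht hu'
  interval_cases c <;> interval_cases c' <;>
    simp only [add_assoc, Nat.reduceAdd, gap_add, gap_values] at h0 h1 h2 <;> omega

theorem wordX_eq_runs {A : Type*} (a b : A) {k : ℕ} (hk : 1 ≤ k) :
    wordX a b k = runs a b [k - 1, k, k - 1, k, k, k - 1] := by
  obtain ⟨m, rfl⟩ := Nat.exists_eq_add_of_le' hk
  simp [wordX, runs, List.replicate_succ]

theorem flatMap_wordX_eq_runs {A : Type*} (a b : A) {i : ℕ} (hi : 1 ≤ i) (n : ℕ) :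
    (List.range' i n).flatMap (wordX a b) =
      runs a b ((List.range (6 * n)).map fun t => i - 1 + gap t) := by
  induction n with
  | zero => simp [runs]
  | succ n ih =>
    rw [List.range'_1_concat, List.flatMap_append, ih, mul_add, List.range_add, List.map_append,
      runs_append, List.flatMap_singleton, wordX_eq_runs a b (by omega)]
    congr 2
    rw [show List.range (6 * 1) = [0, 1, 2, 3, 4, 5] by decide]
    simp only [List.map_cons, List.map_nil, gap_add, gap_values, List.cons.injEq, and_true]
    omega

/-- The tail `a a^{j-1}` is a run of length `j`, which is the value at the last index `6(j+1-i)`; it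
continues the pattern as the first run of a block `X_{j+1}` would. -/
theorem wordY_append_eq_runs {A : Type*} (a b : A) {i j : ℕ} (hi : 1 ≤ i) (hij : i ≤ j) :
    wordY a b i j ++ [b] =
      runs a b ((List.range (6 * (j + 1 - i) + 1)).map fun t => i - 1 + gap t) := by
  rw [wordY, flatMap_wordX_eq_runs a b hi, List.range_succ, List.map_append, runs_append]
  have := gap_add (j + 1 - i) 0
  simp only [add_zero, gap_values] at this
  obtain ⟨m, rfl⟩ : ∃ m, j = m + 1 := ⟨j - 1, by omega⟩
  simp [runs, this, show i - 1 + (m + 1 + 1 - i) = m + 1 by omega, List.replicate_succ]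

theorem length_runs {A : Type*} (a b : A) (L : List ℕ) :
    (runs a b L).length = L.sum + L.length := by
  induction L with
  | nil => rfl
  | cons g L ih => simp [runs_cons, ih]; omega

theorem length_wordY {A : Type*} (a b : A) {i j : ℕ} (hi : 1 ≤ i) (hij : i ≤ j) :
    (wordY a b i j).length + 3 * i ^ 2 = 7 * j + 3 + 3 * j ^ 2 := by
  have key : ∀ n, (runs a b ((List.range (6 * n)).map fun t => i - 1 + gap t)).length =
      6 * n * i + 3 * n ^ 2 := by
    intro n
    rw [length_runs]
    induction n with
    | zero => simp
    | succ n ih =>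
      rw [mul_add, List.range_add, List.map_append, List.sum_append, List.length_append,
        show List.range (6 * 1) = [0, 1, 2, 3, 4, 5] by decide]
      simp only [List.map_cons, List.map_nil, gap_add, gap_values, List.sum_cons, List.sum_nil,
        List.length_cons, List.length_nil]
      obtain ⟨m, rfl⟩ := Nat.exists_eq_add_of_le' hi
      simp only [Nat.add_sub_cancel] at *
      linarith
  rw [wordY, flatMap_wordX_eq_runs a b hi, List.length_append, List.length_append, key]
  obtain ⟨d, rfl⟩ := Nat.exists_eq_add_of_le hij
  rw [show i + d + 1 - i = d + 1 by omega]
  simp only [List.length_singleton, List.length_replicate]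
  obtain ⟨m, rfl⟩ := Nat.exists_eq_add_of_le' hi
  rw [show m + 1 + d - 1 = m + d by omega]
  ring

/-! ### The five families of squares and their number -/

/-- The triples `(r, L k, y k - r)` with `lo ≤ k ≤ hi` and `r < n k`. -/
def family (lo hi : ℕ) (n y : ℕ → ℕ) (L : ℕ → List ℕ) : Finset (ℕ × List ℕ × ℕ) :=
  (Finset.Icc lo hi).biUnion fun k => (Finset.range (n k)).image fun r => (r, L k, y k - r)

theorem mem_family {lo hi : ℕ} {n y : ℕ → ℕ} {L : ℕ → List ℕ} {r s : ℕ} {M : List ℕ} :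
    (r, M, s) ∈ family lo hi n y L ↔ ∃ k, lo ≤ k ∧ k ≤ hi ∧ r < n k ∧ M = L k ∧ s = y k - r := by
  simp only [family, Finset.mem_biUnion, Finset.mem_Icc, Finset.mem_image, Finset.mem_range,
    Prod.mk.injEq]
  constructor
  · rintro ⟨k, ⟨h1, h2⟩, e, he, rfl, rfl, rfl⟩
    exact ⟨k, h1, h2, he, rfl, rfl⟩
  · rintro ⟨k, h1, h2, he, rfl, rfl⟩
    exact ⟨k, ⟨h1, h2⟩, r, he, rfl, rfl, rfl⟩

theorem card_family {lo hi : ℕ} {n y : ℕ → ℕ} {L : ℕ → List ℕ} (hL : Function.Injective L) :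
    (family lo hi n y L).card = ∑ k ∈ Finset.Icc lo hi, n k := by
  rw [family, Finset.card_biUnion]
  · refine Finset.sum_congr rfl fun k _ => ?_
    rw [Finset.card_image_of_injective _ fun r r' h => (Prod.mk.inj h).1, Finset.card_range]
  · intro k _ k' _ hk
    refine Finset.disjoint_left.2 fun x hx hx' => ?_
    obtain ⟨_, _, rfl⟩ := Finset.mem_image.1 hx
    obtain ⟨_, _, h⟩ := Finset.mem_image.1 hx'
    exact hk (hL (Prod.mk.inj (Prod.mk.inj h).2).1).symm

/-- The lower bounds matter because of truncated subtraction: at `k = k' = 0` the lists `[k, k-1,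
k]` and `[k'-1, k', k'-1]` coincide. -/
theorem disjoint_family {lo hi lo' hi' : ℕ} {n y n' y' : ℕ → ℕ} {L L' : ℕ → List ℕ}
    (h : ∀ k k', lo ≤ k → lo' ≤ k' → L k ≠ L' k') :
    Disjoint (family lo hi n y L) (family lo' hi' n' y' L') := by
  refine Finset.disjoint_left.2 fun ⟨r, M, s⟩ hx hx' => ?_
  obtain ⟨k, hk, -, -, hM, -⟩ := mem_family.1 hx
  obtain ⟨k', hk', -, -, hM', -⟩ := mem_family.1 hx'
  exact h k k' hk hk' (hM.symm.trans hM')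

/-- The triples `(r, L, s)` for which `core a b r L s` is a square in `wordY a b i j`. -/
def squareCodes (i j : ℕ) : Finset (ℕ × List ℕ × ℕ) :=
  family (i - 1) j (fun k => k + 1) (fun k => k) (fun k => [k]) ∪
  (family i j (fun k => k) (fun k => k - 1) (fun k => [k, k - 1, k]) ∪
  (family (i + 1) j (fun k => k - 1) (fun k => k) (fun k => [k - 1, k, k - 1]) ∪
  (family i j (fun k => k) (fun k => k) (fun k => [k, k - 1, k, k, k - 1]) ∪
  family i (j - 1) (fun k => k + 1) (fun k => k) (fun k => [k - 1, k, k, k - 1, k]))))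

theorem card_squareCodes {i : ℕ} (j : ℕ) (hi : 1 ≤ i) :
    (squareCodes i j).card =
      ∑ k ∈ Finset.Icc (i - 1) j, (k + 1) + (∑ k ∈ Finset.Icc i j, k +
        (∑ k ∈ Finset.Icc (i + 1) j, (k - 1) + (∑ k ∈ Finset.Icc i j, k +
          ∑ k ∈ Finset.Icc i (j - 1), (k + 1)))) := by
  rw [squareCodes, Finset.card_union_of_disjoint, Finset.card_union_of_disjoint,
    Finset.card_union_of_disjoint, Finset.card_union_of_disjoint, card_family, card_family,
    card_family, card_family, card_family]
  any_goals intro k k' h; simp at h; omega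
  all_goals try simp only [Finset.disjoint_union_right]
  all_goals repeat' apply And.intro
  all_goals
    refine disjoint_family fun k k' hk hk' h => ?_
    simp only [List.cons.injEq, reduceCtorEq, and_false, and_true] at h <;> omega

theorem sum_card_squareCodes {i j : ℕ} (hi : 1 ≤ i) (hij : i < j) :
    2 * (squareCodes i j).card + 5 * i ^ 2 + 3 * j = 8 * j + 2 + 5 * j ^ 2 + 3 * i := by
  rw [card_squareCodes j hi]
  obtain ⟨m, rfl⟩ := Nat.exists_eq_add_of_le' hi
  obtain ⟨d, rfl⟩ := Nat.exists_eq_add_of_lt hij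
  simp only [Nat.add_sub_cancel]
  induction d with
  | zero =>
    rw [add_zero, Finset.sum_Icc_succ_top (a := m) (by omega),
      Finset.sum_Icc_succ_top (a := m) (by omega)]
    simp only [Finset.sum_Icc_succ_top, Finset.Icc_self, Finset.sum_singleton,
      Nat.le_succ_of_le, le_refl, Nat.add_sub_cancel]
    ring
  | succ d ih =>
    rw [← add_assoc (m + 1) d 1, Finset.sum_Icc_succ_top (a := m) (by omega),
      Finset.sum_Icc_succ_top (a := m + 1) (b := m + 1 + d + 1) (by omega),
      Finset.sum_Icc_succ_top (a := m + 1 + 1) (by omega),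
      Finset.sum_Icc_succ_top (f := fun k => k + 1) (a := m + 1) (by omega), Nat.add_sub_cancel]
    have := ih (by omega)
    linarith

/-! ### Classification of the squares containing `b` -/

theorem core_mem_distinctSquares_iff {A : Type*} {a b : A} (hab : a ≠ b) {i j : ℕ} (hi : 1 ≤ i)
    (hij : i ≤ j) (r s : ℕ) (M : List ℕ) :
    core a b r M s ∈ distinctSquares (wordY a b i j) ↔
      ∃ p m, p + 2 * m + 2 ≤ 6 * (j + 1 - i) ∧ r ≤ i - 1 + gap p ∧
        s ≤ i - 1 + gap (p + 2 * m + 2) ∧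
        M = (List.range (2 * m + 1)).map (fun l => i - 1 + gap (p + 1 + l)) ∧
        r + s = i - 1 + gap (p + m + 1) ∧
        ∀ l < m, gap (p + 1 + l) = gap (p + m + 2 + l) := by
  rw [distinctSquares, Set.mem_ofPred_eq, core_eq_square_iff hab,
    core_isInfix_iff hab (wordY_append_eq_runs a b hi hij), map_range_eq_append_iff]
  constructor
  · rintro ⟨⟨p, hp, hr, hs, hM⟩, ms, rfl⟩
    have hl : (ms ++ (s + r) :: ms).length = 2 * ms.length + 1 := by simp; omega
    rw [hl] at hp hs hM
    refine ⟨p, ms.length, hp, hr, hs, hM, ?_, fun l hl => ?_⟩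
    · have := congrArg (fun L => L[ms.length]?) hM
      simp [show ms.length < 2 * ms.length + 1 by omega] at this
      rw [add_right_comm]
      omega
    · have h1 := congrArg (fun L => L[l]?) hM
      have h2 := congrArg (fun L => L[ms.length + 1 + l]?) hM
      simp [show l < 2 * ms.length + 1 by omega, List.getElem?_append_left hl,
        List.getElem?_eq_getElem hl] at h1
      simp [show ms.length + 1 + l < 2 * ms.length + 1 by omega, List.getElem?_append_right,
        show ms.length ≤ ms.length + 1 + l by omega,
        show ms.length + 1 + l - ms.length = l + 1 by omega,
        List.getElem?_eq_getElem hl] at h2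
      rw [h1, show p + 1 + (ms.length + 1 + l) = p + ms.length + 2 + l by omega] at h2
      omega
  · rintro ⟨p, m, hp, hr, hs, hM, hrs, hper⟩
    refine ⟨⟨p, ?_, hr, ?_, ?_⟩, (List.range m).map (fun l => i - 1 + gap (p + 1 + l)), ?_⟩
    · simpa [hM, add_assoc] using hp
    · simpa [hM, add_assoc] using hs
    · rw [hM]; simp
    · rw [hM, show 2 * m + 1 = m + (1 + m) by omega, List.range_add, List.range_add,
        List.map_append]
      congr 1
      simp only [List.range_one, List.map_cons, List.cons_append,
        List.nil_append, List.map_map, List.cons.injEq]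
      refine ⟨by rw [add_comm s, hrs]; congr 2; omega, List.map_congr_left fun l hl => ?_⟩
      simp only [Function.comp]
      rw [hper l (List.mem_range.1 hl)]
      congr 2
      omega

theorem core_mem_distinctSquares_iff_mem {A : Type*} {a b : A} (hab : a ≠ b) {i j : ℕ}
    (hi : 1 ≤ i) (hij : i ≤ j) (r s : ℕ) (M : List ℕ) :
    core a b r M s ∈ distinctSquares (wordY a b i j) ↔ (r, M, s) ∈ squareCodes i j := by
  rw [core_mem_distinctSquares_iff hab hi hij]
  simp only [squareCodes, Finset.mem_union, mem_family]
  constructor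
  · rintro ⟨p, m, hp, hr, hs, rfl, hrs, hper⟩
    have hpq := Nat.div_add_mod p 6
    have hc := Nat.mod_lt p (show 0 < 6 by norm_num)
    generalize p / 6 = q at *
    generalize p % 6 = c at *
    subst hpq
    -- The root contains `m + 1` letters `b`.
    obtain rfl | rfl | rfl | hm : m = 0 ∨ m = 1 ∨ m = 2 ∨ 3 ≤ m := by omega
    · left
      have h1 := gap_le_of_le (show 6 * q + c + 0 + 1 ≤ 6 * (j + 1 - i) by omega)
      refine ⟨r + s, ?_, ?_, ?_, ?_, ?_⟩
      · omega
      · omega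
      · omega
      · rw [hrs]; rfl
      · omega
    · right
      have h0 := hper 0 (by omega)
      rw [show (List.range (2 * 1 + 1)) = [0, 1, 2] by decide]
      simp only [List.map_cons, List.map_nil, List.cons.injEq, and_true]
      -- The repetition condition survives only for residues 0 and 3, which give the same lists `[k,
      -- k-1, k]`, and for residue 5.
      interval_cases c <;>
        simp only [add_assoc, mul_one, Nat.reduceAdd, gap_add, gap_values] at * <;>
        first
        | omega
        | exact Or.inl ⟨r + s + 1, by omega⟩
        | exact Or.inr (Or.inl ⟨r + s, by omega⟩)
    · right; right; right
      have h0 := hper 0 (by omega)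
      have h1 := hper 1 (by omega)
      rw [show (List.range (2 * 2 + 1)) = [0, 1, 2, 3, 4] by decide]
      simp only [List.map_cons, List.map_nil, List.cons.injEq, and_true]
      -- Only residues 0 and 1 survive.
      interval_cases c <;>
        simp only [add_assoc, Nat.reduceMul, Nat.reduceAdd, gap_add, gap_values] at * <;>
        first
        | omega
        | exact Or.inl ⟨r + s, by omega⟩
        | exact Or.inr ⟨r + s, by omega⟩
    · refine (gap_aperiodic (t := 6 * q + c + 1) (d := m + 1) (by omega) ?_ ?_ ?_).elim
      · exact (hper 0 (by omega)).trans (congrArg gap (by omega))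
      · exact (hper 1 (by omega)).trans (congrArg gap (by omega))
      · exact (hper 2 (by omega)).trans (congrArg gap (by omega))
  · rintro (⟨k, hk, hk', hr, rfl, rfl⟩ | ⟨k, hk, hk', hr, rfl, rfl⟩ | ⟨k, hk, hk', hr, rfl, rfl⟩ |
      ⟨k, hk, hk', hr, rfl, rfl⟩ | ⟨k, hk, hk', hr, rfl, rfl⟩)
    -- For `k < j`, the block `X_{k+1}` has a run `k` between two runs `k+1`, which allows every `r
    -- ≤ k`. For `k = j` the runs around an interior run `j` are `j-1, j` or `j, j-1`; the latter is
    -- needed only when `r = j` and `s = 0`.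
    · by_cases hkj : k < j
      · refine ⟨6 * (k + 1 - i) + 1, 0, by omega, ?_⟩
        simp only [List.range_eq_range', List.range', List.map_cons, List.map_nil, List.cons.injEq,
          and_true, add_assoc, Nat.reduceMul, Nat.reduceAdd, gap_add, gap_values,
          Nat.not_lt_zero, false_imp_iff, forall_const]
        omega
      · by_cases hrj : r < j
        · refine ⟨6 * (j - i) + 2, 0, by omega, ?_⟩
          simp only [List.range_eq_range', List.range', List.map_cons, List.map_nil, List.cons.injEq,
            and_true, add_assoc, Nat.reduceMul, Nat.reduceAdd, gap_add, gap_values,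
            Nat.not_lt_zero, false_imp_iff, forall_const]
          omega
        · refine ⟨6 * (j - i) + 3, 0, by omega, ?_⟩
          simp only [List.range_eq_range', List.range', List.map_cons, List.map_nil, List.cons.injEq,
            and_true, add_assoc, Nat.reduceMul, Nat.reduceAdd, gap_add, gap_values,
            Nat.not_lt_zero, false_imp_iff, forall_const]
          omega
    · refine ⟨6 * (k - i) + 0, 1, by omega, ?_⟩
      simp only [List.range_eq_range', List.range', List.map_cons, List.map_nil, List.cons.injEq,
        and_true, add_assoc, Nat.reduceMul, Nat.reduceAdd, gap_add, gap_values,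
        Nat.forall_lt_succ_right, Nat.not_lt_zero, false_imp_iff, forall_const]
      omega
    · refine ⟨6 * (k - i - 1) + 5, 1, by omega, ?_⟩
      simp only [List.range_eq_range', List.range', List.map_cons, List.map_nil, List.cons.injEq,
        and_true, add_assoc, Nat.reduceMul, Nat.reduceAdd, gap_add, gap_values,
        Nat.forall_lt_succ_right, Nat.not_lt_zero, false_imp_iff, forall_const]
      omega
    · refine ⟨6 * (k - i) + 0, 2, by omega, ?_⟩
      simp only [List.range_eq_range', List.range', List.map_cons, List.map_nil, List.cons.injEq,
        and_true, add_assoc, Nat.reduceMul, Nat.reduceAdd, gap_add, gap_values,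
        Nat.forall_lt_succ_right, Nat.not_lt_zero, false_imp_iff, forall_const]
      omega
    · refine ⟨6 * (k - i) + 1, 2, by omega, ?_⟩
      simp only [List.range_eq_range', List.range', List.map_cons, List.map_nil, List.cons.injEq,
        and_true, add_assoc, Nat.reduceMul, Nat.reduceAdd, gap_add, gap_values,
        Nat.forall_lt_succ_right, Nat.not_lt_zero, false_imp_iff, forall_const]
      omega

/-! ### The set of all squares and its cardinality -/

theorem distinctSquares_wordY {A : Type*} {a b : A} (hab : a ≠ b) {i j : ℕ}
    (hi : 1 ≤ i) (hij : i ≤ j) :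
    distinctSquares (wordY a b i j) =
      (fun l => List.replicate (2 * l) a) '' (Finset.Icc 1 (j / 2) : Finset ℕ) ∪
        (fun x : ℕ × List ℕ × ℕ => core a b x.1 x.2.1 x.2.2) '' (squareCodes i j : Set _) := by
  have hY := wordY_append_eq_runs a b hi hij
  have hrep : ∀ r, List.replicate r a <:+: wordY a b i j ↔ r ≤ j := by
    intro r
    simp only [replicate_isInfix_iff hab hY, List.mem_map, List.mem_range]
    constructor
    · rintro ⟨_, ⟨t, ht, rfl⟩, hr⟩
      have := gap_le_of_le (Nat.lt_succ_iff.1 ht)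
      omega
    · intro hr
      have := gap_add (j + 1 - i) 0
      simp only [add_zero, gap_values] at this
      exact ⟨_, ⟨_, Nat.lt_succ_self _, rfl⟩, by omega⟩
  ext w
  simp only [Set.mem_union, Set.mem_image, Finset.mem_coe, Finset.mem_Icc, Prod.exists]
  constructor
  · intro hw
    obtain ⟨L, t, rfl⟩ := exists_eq_runs_append_replicate (a := a) (b := b) w fun c hc =>
      mem_runs (hY ▸ List.mem_append_left _ (hw.1.subset hc))
    cases L with
    | nil =>
      obtain ⟨hw, x, hx, h⟩ := hw
      rw [runs_nil, List.nil_append] at *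
      have hl := congrArg List.length h
      have := (hrep t).1 hw
      have := List.length_pos_iff.2 hx
      simp only [List.length_replicate, List.length_append] at hl
      exact Or.inl ⟨x.length, by omega, by rw [hl, two_mul]⟩
    | cons r M =>
      rw [← core_eq_runs] at *
      exact Or.inr ⟨r, M, t, (core_mem_distinctSquares_iff_mem hab hi hij _ _ _).1 hw, rfl⟩
  · rintro (⟨l, hl, rfl⟩ | ⟨r, M, s, h, rfl⟩)
    · refine ⟨(hrep _).2 (by omega), List.replicate l a, ?_, ?_⟩
      · rw [Ne, List.replicate_eq_nil_iff]; omega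
      · rw [two_mul, List.replicate_add]
    · exact (core_mem_distinctSquares_iff_mem hab hi hij _ _ _).2 h

theorem numDistinctSquares_wordY {A : Type*} {a b : A} (hab : a ≠ b) {i j : ℕ}
    (hi : 1 ≤ i) (hij : i ≤ j) :
    numDistinctSquares (wordY a b i j) = j / 2 + (squareCodes i j).card := by
  rw [numDistinctSquares, distinctSquares_wordY hab hi hij, Set.ncard_union_eq,
    Set.ncard_image_of_injective, Set.ncard_image_of_injective, Set.ncard_coe_finset,
    Set.ncard_coe_finset, Nat.card_Icc, Nat.add_sub_cancel]
  · rintro ⟨r, M, s⟩ ⟨r', M', s'⟩ h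
    obtain ⟨rfl, rfl, rfl⟩ := core_inj hab h
    rfl
  · intro l l' h
    simpa using congrArg List.length h
  · refine Set.disjoint_left.2 ?_
    rintro _ ⟨l, -, rfl⟩ ⟨⟨r, M, s⟩, -, h⟩
    exact replicate_append_cons_ne hab _ _ _ h

/-! ### The limit of the density -/

theorem tendsto_density {f : ℕ → ℝ} (i : ℝ)
    (hf : ∀ᶠ j : ℕ in atTop, f j = (4 * (j : ℝ) + ((j / 2 : ℕ) : ℝ) + 1 +
      (5 * (j : ℝ) ^ 2 - 3 * (j : ℝ) - 5 * i ^ 2 + 3 * i) / 2) /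
      (7 * (j : ℝ) + 3 + 3 * (j : ℝ) ^ 2 - 3 * i ^ 2)) :
    Tendsto f atTop (𝓝 (5 / 6)) := by
  have h1 : Tendsto (fun j : ℕ => ((j : ℝ))⁻¹) atTop (𝓝 0) := tendsto_inv_atTop_nhds_zero_nat
  have h2 : Tendsto (fun j : ℕ => ((j / 2 : ℕ) : ℝ) * (j : ℝ)⁻¹ * (j : ℝ)⁻¹) atTop (𝓝 0) := by
    refine squeeze_zero (fun j => by positivity) (fun j => ?_) h1
    refine mul_le_of_le_one_left (by positivity) (mul_inv_le_one_of_le₀ ?_ (by positivity))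
    exact_mod_cast Nat.div_le_self j 2
  -- Numerator and denominator are divided by `j^2`; the leading coefficients are `5/2` and `3`.
  have h3 : Tendsto (fun j : ℕ => (4 * (j : ℝ)⁻¹ + ((j / 2 : ℕ) : ℝ) * (j : ℝ)⁻¹ * (j : ℝ)⁻¹ +
      (j : ℝ)⁻¹ * (j : ℝ)⁻¹ + (5 - 3 * (j : ℝ)⁻¹ + (-5 * i ^ 2 + 3 * i) *
        ((j : ℝ)⁻¹ * (j : ℝ)⁻¹)) / 2) /
      (7 * (j : ℝ)⁻¹ + 3 + (3 - 3 * i ^ 2) * ((j : ℝ)⁻¹ * (j : ℝ)⁻¹))) atTop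
      (𝓝 ((4 * 0 + 0 + 0 * 0 + (5 - 3 * 0 + (-5 * i ^ 2 + 3 * i) * (0 * 0)) / 2) /
        (7 * 0 + 3 + (3 - 3 * i ^ 2) * (0 * 0)))) := by
    refine Tendsto.div ?_ ?_ (by norm_num)
    · exact ((((h1.const_mul 4).add h2).add (h1.mul h1)).add
        (((tendsto_const_nhds.sub (h1.const_mul 3)).add ((h1.mul h1).const_mul _)).div_const 2))
    · exact ((h1.const_mul 7).add tendsto_const_nhds).add ((h1.mul h1).const_mul _)
  norm_num at h3
  refine h3.congr' ?_
  filter_upwards [hf, eventually_gt_atTop 0] with j hj hj0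
  have hj0' : (j : ℝ) ≠ 0 := by positivity
  rw [hj, ← mul_div_mul_right _ _ (pow_ne_zero 2 hj0')]
  congr 1 <;> field_simp <;> ring

theorem wordY_length_and_squares {A : Type*} {a b : A} (hab : a ≠ b) {i j : ℕ} (hi : 1 ≤ i)
    (hij : i < j) :
    ((wordY a b i j).length : ℚ) = 7 * (j : ℚ) + 3 + 3 * (j : ℚ) ^ 2 - 3 * (i : ℚ) ^ 2 ∧
      (numDistinctSquares (wordY a b i j) : ℚ) =
        4 * (j : ℚ) + ((j / 2 : ℕ) : ℚ) + 1 +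
          (5 * (j : ℚ) ^ 2 - 3 * (j : ℚ) - 5 * (i : ℚ) ^ 2 + 3 * (i : ℚ)) / 2 := by
  constructor
  · have := congrArg (Nat.cast (R := ℚ)) (length_wordY a b hi hij.le)
    push_cast at this
    linarith
  · have := congrArg (Nat.cast (R := ℚ)) (sum_card_squareCodes hi hij)
    rw [numDistinctSquares_wordY hab hi hij.le, Nat.cast_add]
    push_cast at this
    linarith

theorem tendsto_distinctSquareDensity_wordY {A : Type*} {a b : A} (hab : a ≠ b) {i : ℕ}
    (hi : 1 ≤ i) :
    Tendsto (fun j : ℕ => distinctSquareDensity (wordY a b i j)) atTop (𝓝 (5 / 6)) := by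
  refine tendsto_density i ?_
  filter_upwards [eventually_gt_atTop i] with j hj
  obtain ⟨h1, h2⟩ := wordY_length_and_squares hab hi hj
  have h1' := congrArg (Rat.cast (K := ℝ)) h1
  have h2' := congrArg (Rat.cast (K := ℝ)) h2
  simp only [Rat.cast_natCast, Rat.cast_add, Rat.cast_sub, Rat.cast_mul, Rat.cast_pow,
    Rat.cast_div, Rat.cast_ofNat, Rat.cast_one] at h1' h2'
  rw [distinctSquareDensity, h1', h2']

theorem mainTheorem1 {A : Type*} (a b : A) (hab : a ≠ b) :
    (∀ i j : ℕ, 1 ≤ i → i < j →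
      ((wordY a b i j).length : ℚ) = 7 * (j : ℚ) + 3 + 3 * (j : ℚ) ^ 2 - 3 * (i : ℚ) ^ 2 ∧
      (numDistinctSquares (wordY a b i j) : ℚ) =
        4 * (j : ℚ) + ((j / 2 : ℕ) : ℚ) + 1 +
          (5 * (j : ℚ) ^ 2 - 3 * (j : ℚ) - 5 * (i : ℚ) ^ 2 + 3 * (i : ℚ)) / 2) ∧
    (∀ i : ℕ, 1 ≤ i →
      Tendsto (fun j : ℕ => distinctSquareDensity (wordY a b i j)) atTop (𝓝 (5 / 6))) ∧
    (∃ w : ℕ → List A, Tendsto (fun n : ℕ => distinctSquareDensity (w n)) atTop (𝓝 (5 / 6))) :=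
  ⟨fun _ _ hi hij => wordY_length_and_squares hab hi hij,
    fun _ hi => tendsto_distinctSquareDensity_wordY hab hi,
    fun j => wordY a b 1 j, tendsto_distinctSquareDensity_wordY hab le_rfl⟩
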